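/- For a nonzero complex polynomial $Q$ put $$\|Q\|_p=\left(\frac1{2\pi}\int_0^{2\pi}|Q(e^{i\theta})|^p\,d\theta\right)^{1/p}\quad(0<p<\infty),\qquad \|Q\|_0=\exp\left(\frac1{2\pi}\int_0^{2\pi}\log|Q(e^{i\theta})|\,d\theta\right),$$ and write $\|Q(z)\|_p$ for $\|Q\|_p$. Let $P(z)=\sum_{j=0}^n a_jz^j$ be a complex polynomial of degree exactly $n\ge 1$ which does not vanish in $|z|<\rho$, where $\rho\ge 1$ is real. Then for every real $p$ with $0\le p<\infty$ and every $s=0,1,\dots,n-1$, $$\left\|a_nz+\frac{a_s}{\binom ns}\right\|_p\le c_p\,\frac{\|1+z\|_p}{\|\rho^s+z\|_p}\,\|P\|_p,$$ where $c_p=1$ if $s=0$ and $c_p=\dfrac1{\|1+z\|_p}$ if $s>0$. Moreover, if $s=0$ and $a_j=0$ for $j=1,2,\dots,n-1$, then equality holds. -/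

import Mathlib

open Polynomial

/-- The norm (quasi-norm, geometric mean) `‖P‖_p`, for `0 ≤ p < ∞`, of a complex polynomial on the
unit circle. For `p > 0` it is `((1/2π) ∫_0^{2π} |P(e^{iθ})|^p dθ)^{1/p}`; for `p = 0` it is
`exp((1/2π) ∫_0^{2π} log |P(e^{iθ})| dθ)`, that is, the Mahler measure of `P`. -/
noncomputable def hardyNorm (p : ℝ) (P : ℂ[X]) : ℝ :=
  if p = 0 then P.mahlerMeasure
  else Real.circleAverage (fun z : ℂ => ‖P.eval z‖ ^ p) 0 1 ^ (1 / p)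

/-- The constant `c_p`: it is `1` if `s = 0` and `1 / ‖1 + z‖_p` if `s > 0`. -/
noncomputable def visserConst (p : ℝ) (s : ℕ) : ℝ :=
  if s = 0 then 1 else 1 / hardyNorm p (1 + X)

/-!
The proof rests on **Arestov's inequality** (`hardyNorm_szego_le`): if a polynomial `Q` of formal
degree `n` has no zero in the open unit disc and `Q(0) = 1`, then the Szegő composition
`R ↦ ∑ Q_j R_j / n.choose j * z ^ j` does not increase `‖R‖_p` for any `0 ≤ p < ∞`.

For `p = 0` this is the de Bruijn–Springer inequality for the Mahler measure
(`mahlerMeasure_szego_le`). By Szegő's composition theorem (`szego_eval_ne_zero`, a consequence of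
the theorems of Laguerre and Grace) composition with `Q` preserves the absence of zeros in the disc.
Reflecting the zeros of `R` inside the disc gives a zero-free majorant `S` with `|S(0)|` equal to
the Mahler measure of `R`; as `R - c S` has no zero in the disc for `|c| > 1`, the majorisation
survives the composition, and the Mahler measure of the composition of `S` is `|S(0)|`.
For `p > 0`, composition with `Q` fixes constants, so the case `p = 0` applies to `R - a`;
averaging over `|a| = 1` gives the inequality for the means of `log⁺ |R|` by Jensen's formula, and
`u ^ p` is a superposition of the functions `log⁺ (u / r)`.

The multiplier `1 + z ^ n` yields the case `s = 0` (`hardyNorm_leading_add_constant_le`). For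
`s > 0` consider the multipliers `(1 + z) ^ (n - s) * (1 + ω z ^ s)`, which map `P` to `B + ω A`,
where `A` is a multiple of `z ^ s P⁽ˢ⁾(z)`. The hypothesis on the zeros of `P` gives
`ρ ^ s |A| ≤ |B|` on the unit circle (`rho_pow_mul_norm_szego_le`), and averaging
`‖B + ω A‖_p ≤ ‖P‖_p` over `|ω| = 1` gives `‖A‖_p ‖ρ ^ s + z‖_p ≤ ‖P‖_p`
(`hardyNorm_mul_hardyNorm_le`). The case `s = 0` applied to `P⁽ˢ⁾` finishes the proof.
-/

open MeasureTheory

/-! ### Szegő composition -/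

/-- Szegő composition in formal degree `n`: the coefficients of `Q` and `R` are multiplied and
divided by the binomial coefficients `n.choose j`. -/
noncomputable def szego (n : ℕ) (Q R : ℂ[X]) : ℂ[X] :=
  ∑ j ∈ Finset.range (n + 1), C (Q.coeff j * R.coeff j / (n.choose j : ℂ)) * X ^ j

/-- For `j > n` both sides vanish because `n.choose j = 0` and division by zero is zero. -/
theorem szego_coeff (n : ℕ) (Q R : ℂ[X]) (j : ℕ) :
    (szego n Q R).coeff j = Q.coeff j * R.coeff j / (n.choose j : ℂ) := by
  simp only [szego, finsetSum_coeff, coeff_C_mul, coeff_X_pow, mul_ite, mul_one, mul_zero,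
    Finset.sum_ite_eq, Finset.mem_range]
  split_ifs with h
  · rfl
  · rw [Nat.choose_eq_zero_of_lt (by omega)]; simp

theorem szego_eval_one (n : ℕ) (Q R : ℂ[X]) :
    (szego n Q R).eval 1 =
      ∑ j ∈ Finset.range (n + 1), Q.coeff j * R.coeff j / (n.choose j : ℂ) := by
  simp [szego, eval_finsetSum]

theorem Polynomial.natDegree_comp_C_mul_X_le {S : ℂ[X]} {n : ℕ} (hS : S.natDegree ≤ n) (c : ℂ) :
    (S.comp (C c * X)).natDegree ≤ n := by
  rw [natDegree_le_iff_coeff_eq_zero] at hS ⊢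
  intro N hN
  rw [comp_C_mul_X_coeff, hS N hN, zero_mul]

theorem norm_eq_one_of_one_add_eq_zero {v : ℂ} (h : 1 + v = 0) : ‖v‖ = 1 := by
  rw [eq_neg_of_add_eq_zero_right h, norm_neg, norm_one]

theorem szego_comp_C_mul_X (n : ℕ) (Q R : ℂ[X]) (z : ℂ) :
    szego n Q (R.comp (C z * X)) = (szego n Q R).comp (C z * X) := by
  ext j
  simp only [szego_coeff, comp_C_mul_X_coeff]
  ring

theorem szego_add_left (n : ℕ) (Q Q' R : ℂ[X]) :
    szego n (Q + Q') R = szego n Q R + szego n Q' R := by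
  ext j; simp only [szego_coeff, coeff_add]; ring

theorem szego_C_mul_left (n : ℕ) (c : ℂ) (Q R : ℂ[X]) :
    szego n (C c * Q) R = C c * szego n Q R := by
  ext j; simp only [szego_coeff, coeff_C_mul]; ring

theorem szego_sub_right (n : ℕ) (Q R R' : ℂ[X]) :
    szego n Q (R - R') = szego n Q R - szego n Q R' := by
  ext j; simp only [szego_coeff, coeff_sub]; ring

theorem szego_C_mul_right (n : ℕ) (c : ℂ) (Q R : ℂ[X]) :
    szego n Q (C c * R) = C c * szego n Q R := by
  ext j; simp only [szego_coeff, coeff_C_mul]; ring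

/-! ### The theorems of Laguerre, Grace and Szegő -/

/-- Summation of a strict linear inequality over a multiset; strictness fails only for the empty
one. -/
theorem Multiset.eq_zero_or_re_mul_sum_lt (d : ℂ) (B : ℝ) (s : Multiset ℂ)
    (h : ∀ t ∈ s, (d * t).re < B) : s = 0 ∨ (d * s.sum).re < s.card * B := by
  induction s using Multiset.induction_on with
  | empty => simp
  | cons a s ih =>
    right
    have ha := h a (by simp)
    rw [Multiset.sum_cons, mul_add, Complex.add_re, Multiset.card_cons]
    push_cast
    rcases ih (fun t ht => h t (by simp [ht])) with rfl | h'
    · simpa using ha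
    · linarith

/-- **Laguerre's theorem** for the closed unit disc: if `R`, of formal degree `m`, has no zero
there, then neither has its polar derivative with respect to a pole `ζ` in the disc. -/
theorem polarDerivative_eval_ne_zero {m : ℕ} (hm : 0 < m) {R : ℂ[X]} (hR : R.natDegree ≤ m)
    (h0 : ∀ z : ℂ, ‖z‖ ≤ 1 → R.eval z ≠ 0) {z ζ : ℂ} (hz : ‖z‖ ≤ 1) (hζ : ‖ζ‖ ≤ 1) :
    (m : ℂ) * R.eval z ≠ (z - ζ) * (derivative R).eval z := by
  intro heq
  have hRz := h0 z hz
  set s : Multiset ℂ := R.roots.map (fun w => 1 / (z - w)) with hs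
  set T : ℂ := (derivative R).eval z / R.eval z with hT
  have hTs : T = s.sum :=
    (IsAlgClosed.splits R).eval_derivative_div_eval_of_ne_zero hRz
  have hmT : (m : ℂ) = (z - ζ) * T := by rw [hT]; field_simp; linear_combination heq
  have hm' : (0 : ℝ) < m := by exact_mod_cast hm
  -- `q ‖t‖² + 2 Re (z t) < 1` describes the image of `‖w‖ > 1` under `t = 1 / (z - w)`; it is
  -- linearised at the mean `c = T / m`, so that it can be summed over the roots.
  set q : ℝ := 1 - ‖z‖ ^ 2 with hq
  have hq0 : 0 ≤ q := by rw [hq]; nlinarith [norm_nonneg z]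
  set c : ℂ := T / m with hc
  have key : ∀ t ∈ s, ((2 * (q * (starRingEnd ℂ) c + z)) * t).re < 1 + q * ‖c‖ ^ 2 := by
    intro t ht
    obtain ⟨w, hw, rfl⟩ := Multiset.mem_map.1 ht
    have hw1 : 1 < ‖w‖ := by
      by_contra hcon
      exact h0 w (not_lt.1 hcon) (isRoot_of_mem_roots hw)
    have hzw : z - w ≠ 0 := by
      intro h; rw [sub_eq_zero] at h; rw [h] at hz; linarith
    set t : ℂ := 1 / (z - w) with ht'
    have ht0 : t ≠ 0 := by rw [ht']; exact one_div_ne_zero hzw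
    have hwt : w * t = z * t - 1 := by rw [ht']; field_simp; ring
    have h1 : ‖t‖ < ‖z * t - 1‖ := by
      rw [← hwt, norm_mul]
      nlinarith [norm_pos_iff.2 ht0]
    have h2 : ‖t‖ ^ 2 < ‖z * t - 1‖ ^ 2 := by gcongr
    have h3 : 0 ≤ q * ‖t - c‖ ^ 2 := by positivity
    rw [hq] at h3 ⊢
    rw [Complex.sq_norm, Complex.sq_norm, Complex.normSq_apply, Complex.normSq_apply] at h2 h3
    rw [Complex.sq_norm, Complex.sq_norm, Complex.normSq_apply, Complex.normSq_apply]
    simp only [Complex.sub_re, Complex.sub_im, Complex.mul_re, Complex.mul_im, Complex.add_re,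
      Complex.add_im, Complex.ofReal_re, Complex.ofReal_im, Complex.conj_re, Complex.conj_im,
      Complex.one_re, Complex.one_im, Complex.re_ofNat, Complex.im_ofNat] at h2 h3 ⊢
    nlinarith
  have hcard : (s.card : ℝ) ≤ m := by
    rw [hs, Multiset.card_map]
    exact_mod_cast (card_roots' R).trans hR
  rcases Multiset.eq_zero_or_re_mul_sum_lt _ _ s key with h | h
  · rw [hTs, h] at hmT
    simp at hmT
    omega
  · rw [← hTs] at h
    have h4 : (2 * (q * (starRingEnd ℂ) c + z) * T).re < m * (1 + q * ‖c‖ ^ 2) :=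
      h.trans_le (mul_le_mul_of_nonneg_right hcard (by positivity))
    have hmc : (m : ℂ) ≠ 0 := by exact_mod_cast hm.ne'
    have hTc : T = m * c := by rw [hc]; field_simp
    have h5 : ‖z * T - m‖ ≤ ‖T‖ := by
      have : z * T - m = ζ * T := by rw [hmT]; ring
      rw [this, norm_mul]
      nlinarith [norm_nonneg T]
    have h6 : ‖z * c - 1‖ ≤ ‖c‖ := by
      rw [hTc, show z * (m * c) - m = m * (z * c - 1) by ring, norm_mul, norm_mul] at h5
      refine le_of_mul_le_mul_left h5 ?_
      simpa using hm
    have h7 : ‖z * c - 1‖ ^ 2 ≤ ‖c‖ ^ 2 := by gcongr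
    have h8 : (2 * (q * (starRingEnd ℂ) c + z) * c).re < 1 + q * ‖c‖ ^ 2 := by
      rw [hTc, show 2 * (q * (starRingEnd ℂ) c + z) * (m * c)
        = ((m : ℝ) : ℂ) * (2 * (q * (starRingEnd ℂ) c + z) * c) by push_cast; ring,
        Complex.re_ofReal_mul] at h4
      exact lt_of_mul_lt_mul_left h4 hm'.le
    rw [hq] at h8
    rw [Complex.sq_norm, Complex.sq_norm, Complex.normSq_apply, Complex.normSq_apply] at h7 h8
    simp only [Complex.sub_re, Complex.sub_im, Complex.mul_re, Complex.mul_im, Complex.add_re,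
      Complex.add_im, Complex.ofReal_re, Complex.ofReal_im, Complex.conj_re, Complex.conj_im,
      Complex.one_re, Complex.one_im, Complex.re_ofNat, Complex.im_ofNat] at h7 h8
    nlinarith

theorem polarDerivative_natDegree_le {n : ℕ} {R : ℂ[X]} (hR : R.natDegree ≤ n + 1) (u : ℂ) :
    (derivative R - C u * (C ((n : ℂ) + 1) * R - X * derivative R)).natDegree ≤ n := by
  rw [natDegree_le_iff_coeff_eq_zero]
  intro N hN
  obtain ⟨k, rfl⟩ : ∃ k, N = k + 1 := ⟨N - 1, by omega⟩
  have h1 : R.coeff (k + 1 + 1) = 0 := coeff_eq_zero_of_natDegree_lt (by omega)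
  simp only [coeff_sub, coeff_C_mul, coeff_X_mul, coeff_derivative, h1]
  rcases Nat.lt_or_ge n k with h | h
  · have h2 : R.coeff (k + 1) = 0 := coeff_eq_zero_of_natDegree_lt (by omega)
    simp [h2]
  · obtain rfl : k = n := by omega
    ring

/-- Removing the root `u` from `Q` turns `R` into a polar derivative; this is the induction step of
Grace's theorem. -/
theorem szego_X_sub_C_mul_eval_one (n : ℕ) (u : ℂ) {Q : ℂ[X]} (hQ : Q.natDegree ≤ n) (R : ℂ[X]) :
    ((n : ℂ) + 1) * (szego (n + 1) ((X - C u) * Q) R).eval 1 =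
      (szego n Q (derivative R - C u * (C ((n : ℂ) + 1) * R - X * derivative R))).eval 1 := by
  have hn : (n : ℂ) + 1 ≠ 0 := by exact_mod_cast n.succ_ne_zero
  rw [szego_eval_one, szego_eval_one]
  have hlast : Q.coeff (n + 1) = 0 := coeff_eq_zero_of_natDegree_lt (by omega)
  have e1 : ∑ j ∈ Finset.range (n + 1 + 1),
      ((X - C u) * Q).coeff j * R.coeff j / ((n + 1).choose j : ℂ) =
      ∑ j ∈ Finset.range (n + 1), Q.coeff j * R.coeff (j + 1) / ((n + 1).choose (j + 1) : ℂ) -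
      ∑ j ∈ Finset.range (n + 1), u * Q.coeff j * R.coeff j / ((n + 1).choose j : ℂ) := by
    have : ∀ j, ((X - C u) * Q).coeff j * R.coeff j / ((n + 1).choose j : ℂ) =
        (X * Q).coeff j * R.coeff j / ((n + 1).choose j : ℂ) -
        u * Q.coeff j * R.coeff j / ((n + 1).choose j : ℂ) := by
      intro j; rw [sub_mul, coeff_sub, coeff_C_mul]; ring
    simp only [this, Finset.sum_sub_distrib]
    congr 1
    · rw [Finset.sum_range_succ']; simp
    · rw [Finset.sum_range_succ, hlast]; simp
  rw [e1, ← Finset.sum_sub_distrib, Finset.mul_sum]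
  refine Finset.sum_congr rfl fun j hj => ?_
  have hj : j ≤ n := by simpa [Nat.lt_succ_iff] using hj
  have c0 : (n.choose j : ℂ) ≠ 0 := by exact_mod_cast (Nat.choose_pos hj).ne'
  have c1 : ((n + 1).choose j : ℂ) ≠ 0 := by exact_mod_cast (Nat.choose_pos (by omega)).ne'
  have c2 : ((n + 1).choose (j + 1) : ℂ) ≠ 0 := by
    exact_mod_cast (Nat.choose_pos (by omega)).ne'
  have r1 : ((n : ℂ) + 1) * n.choose j = (n + 1).choose (j + 1) * (j + 1) := by
    exact_mod_cast Nat.add_one_mul_choose_eq n j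
  have r2 : (n.choose j : ℂ) * (n + 1) = (n + 1).choose j * (n + 1 - j) := by
    have := Nat.choose_mul_succ_eq n j
    have h' : ((n + 1 - j : ℕ) : ℂ) = n + 1 - j := by
      push_cast [Nat.cast_sub (by omega : j ≤ n + 1)]; ring
    rw [← h']; exact_mod_cast this
  have hX : (X * derivative R).coeff j = j * R.coeff j := by
    cases j with
    | zero => simp
    | succ k => rw [coeff_X_mul, coeff_derivative]; push_cast; ring
  simp only [coeff_sub, coeff_C_mul, hX, coeff_derivative]
  field_simp
  linear_combination (Q.coeff j * R.coeff (j + 1) * (n + 1).choose j) * r1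
    - (Q.coeff j * u * R.coeff j * (n + 1).choose (j + 1)) * r2

/-- **Grace's theorem**: the bilinear pairing `∑ Q_j R_j / n.choose j` does not vanish if `Q` has
no zero in the open unit disc and `R` none in the closed one. -/
theorem szego_eval_one_ne_zero (n : ℕ) (Q R : ℂ[X]) (hQn : Q.natDegree ≤ n)
    (hRn : R.natDegree ≤ n) (hQ : ∀ z : ℂ, ‖z‖ < 1 → Q.eval z ≠ 0)
    (hR : ∀ z : ℂ, ‖z‖ ≤ 1 → R.eval z ≠ 0) : (szego n Q R).eval 1 ≠ 0 := by
  induction n generalizing Q R with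
  | zero =>
    have h1 := hQ 0 (by simp)
    have h2 := hR 0 (by simp)
    rw [← coeff_zero_eq_eval_zero] at h1 h2
    simp [szego_eval_one, h1, h2]
  | succ n ih =>
    rcases Nat.eq_zero_or_pos Q.natDegree with h0 | h0
    · have h1 := hQ 0 (by simp)
      have h2 := hR 0 (by simp)
      rw [← coeff_zero_eq_eval_zero] at h1 h2
      rw [szego_eval_one, Finset.sum_range_succ', Finset.sum_eq_zero]
      · simp [h1, h2]
      · intro j _
        rw [coeff_eq_zero_of_natDegree_lt (by omega : Q.natDegree < j + 1)]; simp
    · obtain ⟨u, hu⟩ := IsAlgClosed.exists_root Q (by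
        intro h; rw [natDegree_eq_zero_iff_degree_le_zero.2 h.le] at h0; omega)
      obtain ⟨Q', rfl⟩ := dvd_iff_isRoot.2 hu
      have hu1 : 1 ≤ ‖u‖ := by
        by_contra hcon
        exact hQ u (not_le.1 hcon) hu
      have hu0 : u ≠ 0 := by rintro rfl; simp at hu1; linarith
      have hQ'0 : Q' ≠ 0 := by rintro rfl; simp at h0
      have hQ'n : Q'.natDegree ≤ n := by
        rw [natDegree_mul (X_sub_C_ne_zero u) hQ'0, natDegree_X_sub_C] at hQn
        omega
      intro hzero
      have := szego_X_sub_C_mul_eval_one n u hQ'n R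
      rw [hzero, mul_zero] at this
      refine ih Q' _ hQ'n (polarDerivative_natDegree_le hRn u) ?_ ?_ this.symm
      · intro z hz hz0
        exact hQ z hz (by rw [eval_mul, hz0, mul_zero])
      · intro z hz hz0
        refine polarDerivative_eval_ne_zero (m := n + 1) n.succ_pos hRn hR hz
          (ζ := -u⁻¹) (by rw [norm_neg, norm_inv]; exact inv_le_one_of_one_le₀ hu1) ?_
        simp only [eval_sub, eval_mul, eval_C, eval_X] at hz0
        push_cast
        field_simp
        linear_combination -hz0

/-- **Szegő's composition theorem**: `szego n` preserves the absence of zeros in the open disc. -/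
theorem szego_eval_ne_zero {n : ℕ} {Q R : ℂ[X]} (hQn : Q.natDegree ≤ n)
    (hRn : R.natDegree ≤ n) (hQ : ∀ z : ℂ, ‖z‖ < 1 → Q.eval z ≠ 0)
    (hR : ∀ z : ℂ, ‖z‖ < 1 → R.eval z ≠ 0) {z : ℂ} (hz : ‖z‖ < 1) :
    (szego n Q R).eval z ≠ 0 := by
  have := szego_eval_one_ne_zero n Q (R.comp (C z * X)) hQn (natDegree_comp_C_mul_X_le hRn z) hQ ?_
  · rw [szego_comp_C_mul_X, eval_comp] at this
    simpa using this
  · intro w hw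
    rw [eval_comp]
    refine hR _ ?_
    simp only [eval_mul, eval_C, eval_X, norm_mul]
    nlinarith [norm_nonneg z, norm_nonneg w]

/-! ### Mahler measure of a Szegő composition -/

theorem Polynomial.ae_eval_circleMap_ne_zero {S : ℂ[X]} (hS : S ≠ 0) :
    ∀ᵐ θ : ℝ, S.eval (circleMap 0 1 θ) ≠ 0 := by
  have h : ({z | S.eval z = 0} : Set ℂ).Countable := by
    refine (S.roots.finite_toSet.subset fun z hz => ?_).countable
    exact (mem_roots hS).2 hz
  exact (h.preimage_circleMap 0 one_ne_zero).ae_notMem _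

theorem Polynomial.mahlerMeasure_mono {S T : ℂ[X]}
    (h : ∀ z : ℂ, ‖z‖ = 1 → ‖S.eval z‖ ≤ ‖T.eval z‖) : S.mahlerMeasure ≤ T.mahlerMeasure := by
  rcases eq_or_ne S 0 with rfl | hS
  · rw [mahlerMeasure_zero]; exact mahlerMeasure_nonneg T
  have hle : ∀ᵐ θ : ℝ, 0 < ‖S.eval (circleMap 0 1 θ)‖ ∧
      ‖S.eval (circleMap 0 1 θ)‖ ≤ ‖T.eval (circleMap 0 1 θ)‖ := by
    filter_upwards [ae_eval_circleMap_ne_zero hS] with θ hθ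
    exact ⟨norm_pos_iff.2 hθ, h _ (by simp)⟩
  have hT : T ≠ 0 := by
    rintro rfl
    obtain ⟨θ, h1, h2⟩ := hle.exists
    simp only [eval_zero, norm_zero] at h2
    linarith
  rw [mahlerMeasure_def_of_ne_zero hS, mahlerMeasure_def_of_ne_zero hT]
  gcongr
  refine intervalIntegral.integral_mono_ae Real.two_pi_pos.le
    (intervalIntegrable_mahlerMeasure S) (intervalIntegrable_mahlerMeasure T) ?_
  filter_upwards [hle] with θ hθ
  exact Real.log_le_log hθ.1 hθ.2

theorem Polynomial.mahlerMeasure_eq_norm_coeff_zero {S : ℂ[X]}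
    (h : ∀ z : ℂ, ‖z‖ < 1 → S.eval z ≠ 0) : S.mahlerMeasure = ‖S.coeff 0‖ := by
  rw [mahlerMeasure_eq_leadingCoeff_mul_prod_roots]
  have h1 : S.roots.map (fun a => max 1 ‖a‖) = S.roots.map (fun a => ‖a‖) := by
    refine Multiset.map_congr rfl fun a ha => max_eq_right ?_
    by_contra hcon
    exact h a (not_le.1 hcon) (isRoot_of_mem_roots ha)
  rw [h1, (IsAlgClosed.splits S).coeff_zero_eq_leadingCoeff_mul_prod_roots]
  simp only [norm_mul, norm_pow, norm_neg, norm_one, one_pow, one_mul]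
  congr 1
  exact (map_multiset_prod (normHom (α := ℂ)) S.roots).symm

/-- The linear factor `X - a`, with the root reflected in the unit circle if `‖a‖ < 1`. -/
noncomputable def reflectedFactor (a : ℂ) : ℂ[X] :=
  if ‖a‖ < 1 then 1 - C (starRingEnd ℂ a) * X else X - C a

theorem reflectedFactor_natDegree_le (a : ℂ) : (reflectedFactor a).natDegree ≤ 1 := by
  unfold reflectedFactor
  split_ifs
  · compute_degree
  · compute_degree

theorem reflectedFactor_eval_ne_zero (a : ℂ) {z : ℂ} (hz : ‖z‖ < 1) :
    (reflectedFactor a).eval z ≠ 0 := by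
  unfold reflectedFactor
  split_ifs with h
  · simp only [eval_sub, eval_one, eval_mul, eval_C, eval_X]
    intro h0
    have : ‖starRingEnd ℂ a * z‖ = 1 := by rw [← sub_eq_zero.1 h0, norm_one]
    rw [norm_mul, RCLike.norm_conj] at this
    nlinarith [norm_nonneg a, norm_nonneg z]
  · simp only [eval_sub, eval_C, eval_X, sub_ne_zero]
    rintro rfl
    exact h hz

theorem norm_coeff_zero_reflectedFactor (a : ℂ) : ‖(reflectedFactor a).coeff 0‖ = max 1 ‖a‖ := by
  unfold reflectedFactor
  split_ifs with h
  · simp [h.le]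
  · simpa using not_lt.1 h

theorem norm_eval_X_sub_C_le_reflectedFactor (a : ℂ) {z : ℂ} (hz : ‖z‖ ≤ 1) :
    ‖(X - C a).eval z‖ ≤ ‖(reflectedFactor a).eval z‖ := by
  unfold reflectedFactor
  split_ifs with h
  · simp only [eval_sub, eval_one, eval_mul, eval_C, eval_X]
    rw [← sq_le_sq₀ (norm_nonneg _) (norm_nonneg _)]
    have h1 : ‖a‖ ^ 2 ≤ 1 := by nlinarith [norm_nonneg a]
    have h2 : ‖z‖ ^ 2 ≤ 1 := by nlinarith [norm_nonneg z]
    have h3 : 0 ≤ (1 - ‖a‖ ^ 2) * (1 - ‖z‖ ^ 2) := mul_nonneg (by linarith) (by linarith)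
    rw [Complex.sq_norm, Complex.sq_norm, Complex.normSq_apply, Complex.normSq_apply] at h3 ⊢
    simp only [Complex.sub_re, Complex.sub_im, Complex.mul_re, Complex.mul_im, Complex.conj_re,
      Complex.conj_im, Complex.one_re, Complex.one_im]
    nlinarith
  · exact le_rfl

/-- Reflecting the zeros in the open unit disc gives a majorant of `R` on the closed disc which has
no zero in the open disc and whose value at `0` is the Mahler measure of `R`. -/
theorem exists_zeroFree_majorant (R : ℂ[X]) (hR : R ≠ 0) :
    ∃ S : ℂ[X], S.natDegree ≤ R.natDegree ∧ (∀ z : ℂ, ‖z‖ < 1 → S.eval z ≠ 0) ∧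
      (∀ z : ℂ, ‖z‖ ≤ 1 → ‖R.eval z‖ ≤ ‖S.eval z‖) ∧ ‖S.coeff 0‖ = R.mahlerMeasure := by
  have aux : ∀ s : Multiset ℂ, ∃ S : ℂ[X], S.natDegree ≤ s.card ∧
      (∀ z : ℂ, ‖z‖ < 1 → S.eval z ≠ 0) ∧
      (∀ z : ℂ, ‖z‖ ≤ 1 → ‖((s.map fun a => X - C a).prod).eval z‖ ≤ ‖S.eval z‖) ∧
      ‖S.coeff 0‖ = (s.map fun a => max 1 ‖a‖).prod := by
    intro s
    induction s using Multiset.induction_on with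
    | empty => exact ⟨1, by simp, by simp, by simp, by simp⟩
    | cons a s ih =>
      obtain ⟨S, h1, h2, h3, h4⟩ := ih
      refine ⟨reflectedFactor a * S, ?_, ?_, ?_, ?_⟩
      · rw [Multiset.card_cons]
        have := natDegree_mul_le (p := reflectedFactor a) (q := S)
        have := reflectedFactor_natDegree_le a
        omega
      · intro z hz
        rw [eval_mul]
        exact mul_ne_zero (reflectedFactor_eval_ne_zero a hz) (h2 z hz)
      · intro z hz
        rw [Multiset.map_cons, Multiset.prod_cons, eval_mul, eval_mul, norm_mul, norm_mul]
        exact mul_le_mul (norm_eval_X_sub_C_le_reflectedFactor a hz) (h3 z hz) (norm_nonneg _)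
          (norm_nonneg _)
      · rw [mul_coeff_zero, norm_mul, norm_coeff_zero_reflectedFactor, h4, Multiset.map_cons,
          Multiset.prod_cons]
  obtain ⟨S, h1, h2, h3, h4⟩ := aux R.roots
  have hlc : R.leadingCoeff ≠ 0 := leadingCoeff_ne_zero.2 hR
  refine ⟨C R.leadingCoeff * S, ?_, ?_, ?_, ?_⟩
  · exact (natDegree_C_mul_le _ _).trans (h1.trans (card_roots' R))
  · intro z hz
    rw [eval_mul, eval_C]
    exact mul_ne_zero hlc (h2 z hz)
  · intro z hz
    conv_lhs => rw [(IsAlgClosed.splits R).eq_prod_roots]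
    rw [eval_mul, eval_mul, norm_mul, norm_mul]
    gcongr
    exact h3 z hz
  · rw [coeff_C_mul, norm_mul, h4, mahlerMeasure_eq_leadingCoeff_mul_prod_roots]

theorem norm_eval_le_of_forall_lt_one {S T : ℂ[X]}
    (h : ∀ z : ℂ, ‖z‖ < 1 → ‖S.eval z‖ ≤ ‖T.eval z‖) {z : ℂ} (hz : ‖z‖ = 1) :
    ‖S.eval z‖ ≤ ‖T.eval z‖ := by
  have hcl : IsClosed {z : ℂ | ‖S.eval z‖ ≤ ‖T.eval z‖} :=
    isClosed_le (by fun_prop) (by fun_prop)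
  have hsub : closure (Metric.ball (0 : ℂ) 1) ⊆ {z : ℂ | ‖S.eval z‖ ≤ ‖T.eval z‖} := by
    refine closure_minimal (fun w hw => h w ?_) hcl
    simpa using hw
  refine hsub ?_
  rw [closure_ball _ one_ne_zero]
  simp [hz]

/-- **De Bruijn–Springer inequality**: Szegő composition with a polynomial which has no zero in the
open unit disc increases the Mahler measure at most by the factor `‖Q(0)‖`. -/
theorem mahlerMeasure_szego_le {n : ℕ} {Q R : ℂ[X]} (hQn : Q.natDegree ≤ n)
    (hRn : R.natDegree ≤ n) (hQ : ∀ z : ℂ, ‖z‖ < 1 → Q.eval z ≠ 0) :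
    (szego n Q R).mahlerMeasure ≤ ‖Q.coeff 0‖ * R.mahlerMeasure := by
  rcases eq_or_ne R 0 with rfl | hR
  · have : szego n Q 0 = 0 := by ext j; simp [szego_coeff]
    simp [this]
  obtain ⟨S, hSn, hS, hRS, hS0⟩ := exists_zeroFree_majorant R hR
  have hSn' := hSn.trans hRn
  have hΛS : ∀ z : ℂ, ‖z‖ < 1 → (szego n Q S).eval z ≠ 0 := fun z hz =>
    szego_eval_ne_zero hQn hSn' hQ hS hz
  have hle : ∀ z : ℂ, ‖z‖ < 1 → ‖(szego n Q R).eval z‖ ≤ ‖(szego n Q S).eval z‖ := by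
    intro z hz
    by_contra! hlt
    -- for `‖c‖ > 1` the polynomial `R - c S` has no zero in the disc, hence neither has its image
    set c := (szego n Q R).eval z / (szego n Q S).eval z with hc
    have hc1 : 1 < ‖c‖ := by
      rw [hc, norm_div]
      exact (one_lt_div (norm_pos_iff.2 (hΛS z hz))).2 hlt
    have hdeg : (R - C c * S).natDegree ≤ n :=
      (natDegree_sub_le_of_le hRn ((natDegree_C_mul_le _ _).trans hSn')).trans (max_self n).le
    refine szego_eval_ne_zero hQn hdeg hQ (fun w hw h0 => ?_) hz ?_
    · rw [eval_sub, eval_mul, eval_C, sub_eq_zero] at h0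
      have h1 := hRS w hw.le
      rw [h0, norm_mul] at h1
      have := norm_pos_iff.2 (hS w hw)
      nlinarith
    · rw [szego_sub_right, szego_C_mul_right, eval_sub, eval_mul, eval_C, hc,
        div_mul_cancel₀ _ (hΛS z hz), sub_self]
  calc (szego n Q R).mahlerMeasure
      ≤ (szego n Q S).mahlerMeasure :=
        mahlerMeasure_mono fun z hz => norm_eval_le_of_forall_lt_one hle hz
    _ = ‖Q.coeff 0‖ * R.mahlerMeasure := by
        rw [mahlerMeasure_eq_norm_coeff_zero hΛS, szego_coeff, ← hS0]
        simp

/-! ### Arestov's inequality -/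

theorem circleIntegrable_of_continuous {f : ℂ → ℝ} (hf : Continuous f) : CircleIntegrable f 0 1 :=
  hf.continuousOn.circleIntegrable'

/-- Jensen's formula, averaged over the constant `a` on the unit circle. -/
theorem circleAverage_posLog_eq_circleAverage_logMahlerMeasure (R : ℂ[X]) :
    Real.circleAverage (fun z => Real.posLog ‖R.eval z‖) 0 1 =
      Real.circleAverage (fun a => (R - C a).logMahlerMeasure) 0 1 := by
  have hmer : Meromorphic fun z => R.eval z :=
    fun z => (analyticOnNhd_id.aeval_polynomial R).meromorphicOn z (Set.mem_univ z)
  have h := congrFun (ValueDistribution.circleAverage_circleAverage_eq_proximity_top hmer) 1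
  rw [ValueDistribution.proximity_top] at h
  rw [← h]
  simp [logMahlerMeasure_def]

theorem circleIntegrable_logMahlerMeasure_sub_C (R : ℂ[X]) :
    CircleIntegrable (fun a => (R - C a).logMahlerMeasure) 0 1 := by
  have hmer : Meromorphic fun z => R.eval z :=
    fun z => (analyticOnNhd_id.aeval_polynomial R).meromorphicOn z (Set.mem_univ z)
  have h := ValueDistribution.circleIntegrable_circleAverage_log_norm_sub (R := 1) hmer
  simpa [logMahlerMeasure_def] using h

theorem szego_sub_C {n : ℕ} {Q : ℂ[X]} (hQ : Q.coeff 0 = 1) (R : ℂ[X]) (a : ℂ) :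
    szego n Q (R - C a) = szego n Q R - C a := by
  ext j
  rw [szego_coeff, coeff_sub, coeff_sub, szego_coeff, coeff_C]
  split_ifs with h
  · simp [h, hQ]
  · simp

/-- The hypothesis on `R.coeff 0` guarantees that `R - C a` and its image are nonzero whenever
`‖a‖ = 1`. -/
theorem circleAverage_posLog_szego_le {n : ℕ} {Q R : ℂ[X]} (hQn : Q.natDegree ≤ n)
    (hRn : R.natDegree ≤ n) (hQ : ∀ z : ℂ, ‖z‖ < 1 → Q.eval z ≠ 0) (hQ0 : Q.coeff 0 = 1)
    (hR0 : ‖R.coeff 0‖ ≠ 1) :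
    Real.circleAverage (fun z => Real.posLog ‖(szego n Q R).eval z‖) 0 1 ≤
      Real.circleAverage (fun z => Real.posLog ‖R.eval z‖) 0 1 := by
  rw [circleAverage_posLog_eq_circleAverage_logMahlerMeasure,
    circleAverage_posLog_eq_circleAverage_logMahlerMeasure]
  refine Real.circleAverage_mono (circleIntegrable_logMahlerMeasure_sub_C _)
    (circleIntegrable_logMahlerMeasure_sub_C _) fun a ha => ?_
  have ha : ‖a‖ = 1 := by simpa using ha
  have hne : szego n Q (R - C a) ≠ 0 := by
    intro h
    have h0 := congrArg (fun S => coeff S 0) h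
    simp only [szego_coeff, hQ0, coeff_sub, coeff_C_zero, coeff_zero, Nat.choose_zero_right,
      Nat.cast_one, one_mul, div_one, sub_eq_zero] at h0
    exact hR0 (h0 ▸ ha)
  rw [← szego_sub_C hQ0, logMahlerMeasure_eq_log_MahlerMeasure,
    logMahlerMeasure_eq_log_MahlerMeasure]
  refine Real.log_le_log (mahlerMeasure_pos_of_ne_zero hne) ?_
  have h := mahlerMeasure_szego_le (R := R - C a) hQn
    ((natDegree_sub_le_of_le hRn (natDegree_C a).le).trans (by simp)) hQ
  simpa [hQ0] using h

/-- The power `u ^ p` is a superposition of the functions `log⁺ (u / r)`, `r = exp t`. -/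
theorem lintegral_posLog_eq_rpow {p : ℝ} (hp : 0 < p) {u : ℝ} (hu : 0 ≤ u) :
    ∫⁻ t : ℝ, ENNReal.ofReal (p ^ 2 * Real.exp (p * t) * Real.posLog (u * Real.exp (-t))) =
      ENNReal.ofReal (u ^ p) := by
  rcases hu.eq_or_lt with rfl | hu
  · simp [Real.zero_rpow hp.ne']
  rw [← lintegral_sub_left_eq_self _ (Real.log u)]
  have hint : ∫ τ in Set.Ioi (0 : ℝ), p ^ 2 * u ^ p * (τ ^ ((2 : ℝ) - 1) * Real.exp (-(p * τ))) =
      u ^ p := by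
    rw [integral_const_mul, Real.integral_rpow_mul_exp_neg_mul_Ioi two_pos hp, Real.Gamma_two]
    rw [Real.rpow_two]
    field_simp
  have hup : 0 < u ^ p := Real.rpow_pos_of_pos hu p
  have hintegrable : Integrable
      (fun τ : ℝ => p ^ 2 * u ^ p * (τ ^ ((2 : ℝ) - 1) * Real.exp (-(p * τ))))
      (volume.restrict (Set.Ioi 0)) := by
    refine Integrable.of_integral_ne_zero ?_
    rw [hint]; exact hup.ne'
  conv_rhs => rw [← hint]
  rw [ofReal_integral_eq_lintegral_ofReal hintegrable, ← lintegral_indicator measurableSet_Ioi]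
  · refine lintegral_congr fun τ => ?_
    have h1 : u * Real.exp (-(Real.log u - τ)) = Real.exp τ := by
      rw [neg_sub, Real.exp_sub, Real.exp_log hu]; field_simp
    have h2 : Real.exp (p * (Real.log u - τ)) = u ^ p * Real.exp (-(p * τ)) := by
      rw [mul_sub, sub_eq_add_neg, Real.exp_add, Real.rpow_def_of_pos hu, mul_comm p]
    rw [h1, h2, Real.posLog_apply, Real.log_exp]
    by_cases hτ : τ ∈ Set.Ioi (0 : ℝ)
    · rw [Set.indicator_of_mem hτ, max_eq_right (le_of_lt hτ)]
      norm_num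
      congr 1; ring
    · rw [Set.indicator_of_notMem hτ, max_eq_left (not_lt.1 hτ)]
      simp
  · filter_upwards [ae_restrict_mem measurableSet_Ioi] with τ hτ
    have : (0 : ℝ) < τ := hτ
    positivity

theorem ofReal_integral_circleMap {f : ℂ → ℝ} (hf : Continuous f) (h0 : ∀ z, 0 ≤ f z) :
    ENNReal.ofReal (∫ θ in (0)..(2 * Real.pi), f (circleMap 0 1 θ)) =
      ∫⁻ θ in Set.Ioc 0 (2 * Real.pi), ENNReal.ofReal (f (circleMap 0 1 θ)) := by
  rw [intervalIntegral.integral_of_le Real.two_pi_pos.le, ofReal_integral_eq_lintegral_ofReal]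
  · exact (intervalIntegrable_iff_integrableOn_Ioc_of_le Real.two_pi_pos.le).1
      (circleIntegrable_of_continuous hf)
  · exact Filter.Eventually.of_forall fun θ => h0 _

theorem continuous_norm_eval_rpow (R : ℂ[X]) {p : ℝ} (hp : 0 ≤ p) :
    Continuous fun z : ℂ => ‖R.eval z‖ ^ p :=
  (R.continuous.norm).rpow_const fun _ => Or.inr hp

theorem lintegral_norm_rpow_eq (R : ℂ[X]) {p : ℝ} (hp : 0 < p) :
    ENNReal.ofReal (∫ θ in (0)..(2 * Real.pi), ‖R.eval (circleMap 0 1 θ)‖ ^ p) =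
      ∫⁻ t : ℝ, ENNReal.ofReal (p ^ 2 * Real.exp (p * t)) * ENNReal.ofReal
        (∫ θ in (0)..(2 * Real.pi),
          Real.posLog ‖(C (Real.exp (-t) : ℂ) * R).eval (circleMap 0 1 θ)‖) := by
  rw [ofReal_integral_circleMap (continuous_norm_eval_rpow R hp.le) fun z => by positivity]
  simp_rw [← lintegral_posLog_eq_rpow hp (norm_nonneg _)]
  rw [lintegral_lintegral_swap]
  · refine lintegral_congr fun t => ?_
    rw [ofReal_integral_circleMap (f := fun z => Real.posLog ‖(C (Real.exp (-t) : ℂ) * R).eval z‖)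
      (Real.continuous_posLog.comp (Polynomial.continuous _).norm) fun z => Real.posLog_nonneg,
      ← lintegral_const_mul' _ _ ENNReal.ofReal_ne_top]
    refine lintegral_congr fun θ => ?_
    rw [← ENNReal.ofReal_mul (by positivity)]
    congr 3
    rw [eval_mul, eval_C, norm_mul, mul_comm, Complex.norm_real,
      Real.norm_of_nonneg (Real.exp_pos _).le]
  · refine Measurable.aemeasurable ?_
    refine Continuous.measurable ?_
    refine ENNReal.continuous_ofReal.comp ?_
    have := R.continuous
    have := Real.continuous_posLog
    fun_prop

/-- **Arestov's inequality**: if `Q` has no zero in the open unit disc and `Q(0) = 1`, then Szegő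
composition with `Q` does not increase any of the norms `‖·‖_p`. -/
theorem hardyNorm_szego_le {n : ℕ} {Q R : ℂ[X]} (hQn : Q.natDegree ≤ n)
    (hRn : R.natDegree ≤ n) (hQ : ∀ z : ℂ, ‖z‖ < 1 → Q.eval z ≠ 0) (hQ0 : Q.coeff 0 = 1)
    {p : ℝ} (hp : 0 ≤ p) : hardyNorm p (szego n Q R) ≤ hardyNorm p R := by
  rcases hp.eq_or_lt with rfl | hp
  · simpa [hardyNorm, hQ0] using mahlerMeasure_szego_le hQn hRn hQ
  rw [hardyNorm, if_neg hp.ne', hardyNorm, if_neg hp.ne']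
  refine Real.rpow_le_rpow (Real.circleAverage_nonneg_of_nonneg fun z _ => by positivity) ?_
    (by positivity)
  rw [Real.circleAverage_def, Real.circleAverage_def]
  refine smul_le_smul_of_nonneg_left ?_ (inv_nonneg.2 Real.two_pi_pos.le)
  refine (ENNReal.ofReal_le_ofReal_iff ?_).1 ?_
  · exact intervalIntegral.integral_nonneg Real.two_pi_pos.le fun θ _ => by positivity
  rw [lintegral_norm_rpow_eq _ hp, lintegral_norm_rpow_eq _ hp]
  refine lintegral_mono_ae ?_
  have hae : ∀ᵐ t : ℝ, t ≠ Real.log ‖R.coeff 0‖ := by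
    simp [ae_iff]
  filter_upwards [hae] with t ht
  gcongr
  have hne : ‖(C (Real.exp (-t) : ℂ) * R).coeff 0‖ ≠ 1 := by
    rw [coeff_C_mul, norm_mul, Complex.norm_real,
      Real.norm_of_nonneg (Real.exp_pos _).le]
    intro h
    apply ht
    rw [Real.exp_neg, inv_mul_eq_one₀ (Real.exp_pos t).ne'] at h
    rw [← h, Real.log_exp]
  have := circleAverage_posLog_szego_le hQn ((natDegree_C_mul_le _ R).trans hRn) hQ hQ0 hne
  rw [szego_C_mul_right, Real.circleAverage_def, Real.circleAverage_def, smul_eq_mul,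
    smul_eq_mul] at this
  exact le_of_mul_le_mul_left this (inv_pos.2 Real.two_pi_pos)

/-! ### Properties of the norms -/

theorem hardyNorm_nonneg (p : ℝ) (R : ℂ[X]) : 0 ≤ hardyNorm p R := by
  unfold hardyNorm
  split_ifs
  · exact mahlerMeasure_nonneg R
  · exact Real.rpow_nonneg (Real.circleAverage_nonneg_of_nonneg fun z _ => by positivity) _

theorem hardyNorm_rpow {p : ℝ} (hp : 0 < p) (R : ℂ[X]) :
    hardyNorm p R ^ p = Real.circleAverage (fun z : ℂ => ‖R.eval z‖ ^ p) 0 1 := by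
  rw [hardyNorm, if_neg hp.ne', ← Real.rpow_mul
    (Real.circleAverage_nonneg_of_nonneg fun z _ => by positivity), one_div_mul_cancel hp.ne',
    Real.rpow_one]

theorem hardyNorm_mono {p : ℝ} (hp : 0 ≤ p) {S T : ℂ[X]}
    (h : ∀ z : ℂ, ‖z‖ = 1 → ‖S.eval z‖ ≤ ‖T.eval z‖) : hardyNorm p S ≤ hardyNorm p T := by
  rcases hp.eq_or_lt with rfl | hp
  · simpa [hardyNorm] using mahlerMeasure_mono h
  rw [← Real.rpow_le_rpow_iff (hardyNorm_nonneg p S) (hardyNorm_nonneg p T) hp,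
    hardyNorm_rpow hp, hardyNorm_rpow hp]
  refine Real.circleAverage_mono
    (circleIntegrable_of_continuous (continuous_norm_eval_rpow S hp.le))
    (circleIntegrable_of_continuous (continuous_norm_eval_rpow T hp.le)) fun z hz => ?_
  exact Real.rpow_le_rpow (norm_nonneg _) (h z (by simpa using hz)) hp.le

theorem hardyNorm_congr {p : ℝ} (hp : 0 ≤ p) {S T : ℂ[X]}
    (h : ∀ z : ℂ, ‖z‖ = 1 → ‖S.eval z‖ = ‖T.eval z‖) : hardyNorm p S = hardyNorm p T :=
  le_antisymm (hardyNorm_mono hp fun z hz => (h z hz).le)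
    (hardyNorm_mono hp fun z hz => (h z hz).ge)

theorem hardyNorm_C {p : ℝ} (hp : 0 ≤ p) (c : ℂ) : hardyNorm p (C c) = ‖c‖ := by
  rcases hp.eq_or_lt with rfl | hp
  · simp [hardyNorm]
  rw [hardyNorm, if_neg hp.ne']
  simp only [eval_C, Real.circleAverage_const]
  rw [← Real.rpow_mul (norm_nonneg c), mul_one_div_cancel hp.ne', Real.rpow_one]

theorem hardyNorm_C_mul {p : ℝ} (hp : 0 ≤ p) (c : ℂ) (R : ℂ[X]) :
    hardyNorm p (C c * R) = ‖c‖ * hardyNorm p R := by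
  rcases hp.eq_or_lt with rfl | hp
  · simp [hardyNorm, mahlerMeasure_mul]
  rw [hardyNorm, if_neg hp.ne', hardyNorm, if_neg hp.ne']
  simp only [eval_mul, eval_C, norm_mul, Real.mul_rpow (norm_nonneg _) (norm_nonneg _)]
  have h := Real.circleAverage_fun_smul (a := ‖c‖ ^ p) (f := fun z : ℂ => ‖R.eval z‖ ^ p)
    (c := 0) (R := 1)
  simp only [smul_eq_mul] at h
  rw [h, Real.mul_rpow (by positivity)
    (Real.circleAverage_nonneg_of_nonneg fun z _ => by positivity), ← Real.rpow_mul (norm_nonneg c),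
    mul_one_div_cancel hp.ne', Real.rpow_one]

/-- All the norms `‖·‖_p` are determined by the distribution of `‖R z‖` on the unit circle. -/
theorem hardyNorm_eq_of_circleAverage_eq (p : ℝ) {S T : ℂ[X]} (h0 : S = 0 ↔ T = 0)
    (h : ∀ φ : ℝ → ℝ, Real.circleAverage (fun z => φ ‖S.eval z‖) 0 1 =
      Real.circleAverage (fun z => φ ‖T.eval z‖) 0 1) : hardyNorm p S = hardyNorm p T := by
  unfold hardyNorm
  split_ifs with hp
  · rw [mahlerMeasure, mahlerMeasure, logMahlerMeasure_def, logMahlerMeasure_def, h Real.log]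
    simp only [ne_eq, h0]
  · rw [h fun u => u ^ p]

/-! ### Binomials and Visser's inequality -/

theorem C_mul_X_pow_add_C_eq_zero_iff {m : ℕ} (hm : 0 < m) (a b : ℂ) :
    C a * X ^ m + C b = 0 ↔ a = 0 ∧ b = 0 := by
  constructor
  · intro h
    have h1 := congrArg (fun S => coeff S m) h
    have h0 := congrArg (fun S => coeff S 0) h
    simp only [coeff_add, coeff_C_mul, coeff_X_pow, coeff_C, hm.ne', hm.ne, if_true, if_false,
      coeff_zero] at h0 h1
    simp only [mul_one, add_zero, mul_zero, zero_add] at h0 h1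
    exact ⟨h1, h0⟩
  · rintro ⟨rfl, rfl⟩; simp

theorem hardyNorm_C_mul_X_add_C_swap (p : ℝ) (a b : ℂ) :
    hardyNorm p (C a * X + C b) = hardyNorm p (C b * X + C a) := by
  refine hardyNorm_eq_of_circleAverage_eq p ?_ fun φ => ?_
  · have h1 := C_mul_X_pow_add_C_eq_zero_iff one_pos a b
    have h2 := C_mul_X_pow_add_C_eq_zero_iff one_pos b a
    rw [pow_one] at h1 h2
    rw [h1, h2, and_comm]
  · rw [← Real.circleAverage_zero_one_congr_inv]
    refine Real.circleAverage_congr_sphere fun z hz => ?_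
    have hz : ‖z‖ = 1 := by simpa using hz
    have hz0 : z ≠ 0 := by rintro rfl; simp at hz
    have : eval z⁻¹ (C a * X + C b) = z⁻¹ * eval z (C b * X + C a) := by
      simp only [eval_add, eval_mul, eval_C, eval_X]; field_simp; ring
    simp only [this, norm_mul, norm_inv, hz, inv_one, one_mul]

theorem circleAverage_comp_pow {m : ℕ} (hm : 0 < m) (f : ℂ → ℝ) :
    Real.circleAverage (fun z => f (z ^ m)) 0 1 = Real.circleAverage f 0 1 := by
  rw [Real.circleAverage_def, Real.circleAverage_def]
  congr 1
  have hm' : (m : ℝ) ≠ 0 := by exact_mod_cast hm.ne'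
  have hper : Function.Periodic (fun θ => f (circleMap 0 1 θ)) (2 * Real.pi) := fun θ => by
    simp only [periodic_circleMap 0 1 θ]
  calc ∫ θ in (0)..(2 * Real.pi), f (circleMap 0 1 θ ^ m)
      = ∫ θ in (0)..(2 * Real.pi), (fun θ => f (circleMap 0 1 θ)) (m * θ) := by
        congr 1; ext θ
        congr 1
        simp only [circleMap, zero_add, Complex.ofReal_one, one_mul, ← Complex.exp_nat_mul]
        congr 1; push_cast; ring
    _ = (m : ℝ)⁻¹ • ∫ θ in (m * 0)..(m * (2 * Real.pi)), f (circleMap 0 1 θ) := by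
        rw [intervalIntegral.integral_comp_mul_left (fun θ => f (circleMap 0 1 θ)) hm']
    _ = ∫ θ in (0)..(2 * Real.pi), f (circleMap 0 1 θ) := by
        rw [mul_zero]
        -- without integrability both integrals are zero
        by_cases hint : IntervalIntegrable (fun θ => f (circleMap 0 1 θ)) volume 0 (2 * Real.pi)
        · have h := hper.intervalIntegral_add_zsmul_eq (m : ℤ) 0
            (hper.intervalIntegrable₀ Real.two_pi_pos.ne' hint)
          simp only [zero_add, natCast_zsmul, nsmul_eq_mul] at h
          rw [h, smul_eq_mul, inv_mul_cancel_left₀ hm']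
        · rw [intervalIntegral.integral_undef hint, intervalIntegral.integral_undef, smul_zero]
          refine fun h => hint (h.mono_set ?_)
          have h1 : (1 : ℝ) ≤ m := by exact_mod_cast hm
          have h2 : 2 * Real.pi ≤ m * (2 * Real.pi) := le_mul_of_one_le_left Real.two_pi_pos.le h1
          rw [Set.uIcc_of_le Real.two_pi_pos.le, Set.uIcc_of_le (Real.two_pi_pos.le.trans h2)]
          exact Set.Icc_subset_Icc_right h2

theorem hardyNorm_C_mul_X_pow_add_C (p : ℝ) {m : ℕ} (hm : 0 < m) (a b : ℂ) :
    hardyNorm p (C a * X ^ m + C b) = hardyNorm p (C a * X + C b) := by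
  refine hardyNorm_eq_of_circleAverage_eq p ?_ fun φ => ?_
  · have h1 := C_mul_X_pow_add_C_eq_zero_iff one_pos a b
    rw [pow_one] at h1
    rw [h1, C_mul_X_pow_add_C_eq_zero_iff hm a b]
  · have h := circleAverage_comp_pow hm fun z => φ ‖(C a * X + C b).eval z‖
    simpa using h

theorem szego_one_add_X_pow {m : ℕ} (hm : 0 < m) (R : ℂ[X]) :
    szego m (1 + X ^ m) R = C (R.coeff m) * X ^ m + C (R.coeff 0) := by
  ext j
  rw [szego_coeff]
  simp only [coeff_add, coeff_one, coeff_X_pow, coeff_C_mul, coeff_C]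
  rcases eq_or_ne j 0 with rfl | h0
  · simp [hm.ne]
  · rcases eq_or_ne j m with rfl | h1
    · simp [h0]
    · simp [h0, h1]

/-- **Visser's inequality** in all the norms `‖·‖_p`, `0 ≤ p < ∞`. -/
theorem hardyNorm_leading_add_constant_le {p : ℝ} (hp : 0 ≤ p) {m : ℕ} (hm : 0 < m) {R : ℂ[X]}
    (hR : R.natDegree ≤ m) :
    hardyNorm p (C (R.coeff m) * X + C (R.coeff 0)) ≤ hardyNorm p R := by
  rw [← hardyNorm_C_mul_X_pow_add_C p hm, ← szego_one_add_X_pow hm]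
  refine hardyNorm_szego_le (by compute_degree) hR (fun z hz h => ?_) (by simp [hm.ne]) hp
  simp only [eval_add, eval_one, eval_pow, eval_X] at h
  have h1 : ‖z‖ ^ m = 1 := by rw [← norm_pow, norm_eq_one_of_one_add_eq_zero h]
  exact (pow_lt_one₀ (norm_nonneg z) hz hm.ne').ne h1

/-- The norm of a linear polynomial is monotone in the modulus of its leading coefficient; this is
Arestov's inequality in formal degree one, with multiplier `1 + t z`. -/
theorem hardyNorm_smul_X_add_C_le {p : ℝ} (hp : 0 ≤ p) {t : ℂ} (ht : ‖t‖ ≤ 1) (a b : ℂ) :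
    hardyNorm p (C (t * a) * X + C b) ≤ hardyNorm p (C a * X + C b) := by
  have h : szego 1 (1 + C t * X) (C a * X + C b) = C (t * a) * X + C b := by
    ext j
    rw [szego_coeff]
    rcases j with _ | _ | j
    · simp
    · simp [coeff_one, coeff_C]
    · simp [coeff_one]
  rw [← h]
  refine hardyNorm_szego_le (by compute_degree) (by compute_degree) (fun z hz h0 => ?_)
    (by simp) hp
  simp only [eval_add, eval_one, eval_mul, eval_C, eval_X] at h0
  have h1 := norm_eq_one_of_one_add_eq_zero h0
  rw [norm_mul] at h1
  nlinarith [norm_nonneg z, norm_nonneg t]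

theorem norm_le_hardyNorm_C_mul_X_add_C {p : ℝ} (hp : 0 ≤ p) (a b : ℂ) :
    ‖b‖ ≤ hardyNorm p (C a * X + C b) := by
  have h := hardyNorm_smul_X_add_C_le hp (t := 0) (by simp) a b
  rwa [zero_mul, C_0, zero_mul, zero_add, hardyNorm_C hp] at h

theorem hardyNorm_linear_mono_const {p : ℝ} (hp : 0 ≤ p) (a : ℂ) {b c : ℂ} (h : ‖b‖ ≤ ‖c‖) :
    hardyNorm p (C a * X + C b) ≤ hardyNorm p (C a * X + C c) := by
  rw [hardyNorm_C_mul_X_add_C_swap p a b, hardyNorm_C_mul_X_add_C_swap p a c]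
  rcases eq_or_ne c 0 with rfl | hc
  · obtain rfl : b = 0 := by simpa using h
    exact le_rfl
  · have := hardyNorm_smul_X_add_C_le hp (t := b / c)
      (by rw [norm_div]; exact div_le_one_of_le₀ h (norm_nonneg c)) c a
    rwa [div_mul_cancel₀ _ hc] at this

/-! ### Averaging over a rotation -/

theorem circleAverage_circleAverage_swap {F : ℂ × ℂ → ℝ} (hF : Continuous F) :
    Real.circleAverage (fun z => Real.circleAverage (fun w => F (z, w)) 0 1) 0 1 =
      Real.circleAverage (fun w => Real.circleAverage (fun z => F (z, w)) 0 1) 0 1 := by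
  simp only [Real.circleAverage_def, intervalIntegral.integral_smul]
  rw [intervalIntegral_intervalIntegral_swap]
  have hc : Continuous fun x : ℝ × ℝ => F (circleMap 0 1 x.1, circleMap 0 1 x.2) := by fun_prop
  exact ((hc.continuousOn (s := Set.uIcc 0 (2 * Real.pi) ×ˢ Set.uIcc 0 (2 * Real.pi))
    ).integrableOn_compact (isCompact_uIcc.prod isCompact_uIcc)).mono_set
    (Set.prod_mono Set.uIoc_subset_uIcc Set.uIoc_subset_uIcc)

theorem continuous_circleAverage_left {F : ℂ × ℂ → ℝ} (hF : Continuous F) :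
    Continuous fun z => Real.circleAverage (fun w => F (z, w)) 0 1 := by
  simp only [Real.circleAverage_def]
  have hc : Continuous (Function.uncurry fun (z : ℂ) (θ : ℝ) => F (z, circleMap 0 1 θ)) := by
    fun_prop
  exact (intervalIntegral.continuous_parametric_intervalIntegral_of_continuous' hc 0
    (2 * Real.pi)).const_smul (2 * Real.pi)⁻¹

/-- If `r ‖A‖ ≤ ‖B‖` on the unit circle, a bound for all the polynomials `B + ω A` gives one for
`A`; it is obtained by averaging over `ω` on the unit circle. -/
theorem hardyNorm_mul_hardyNorm_le {p : ℝ} (hp : 0 ≤ p) {A B : ℂ[X]} {r N : ℝ} (hr : 1 ≤ r)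
    (hAB : ∀ z : ℂ, ‖z‖ = 1 → r * ‖A.eval z‖ ≤ ‖B.eval z‖)
    (hN : ∀ ω : ℂ, ‖ω‖ ≤ 1 → hardyNorm p (B + C ω * A) ≤ N) :
    hardyNorm p A * hardyNorm p (X + C (r : ℂ)) ≤ N := by
  have hr0 : (0 : ℝ) ≤ r := by linarith
  have hN0 : 0 ≤ N := (hardyNorm_nonneg _ _).trans (hN 0 (by simp))
  rcases hp.eq_or_lt with rfl | hp
  · have h1 : hardyNorm 0 (X + C (r : ℂ)) = r := by
      simp [hardyNorm, abs_of_nonneg hr0, hr]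
    have h2 : hardyNorm 0 (C (r : ℂ) * A) ≤ hardyNorm 0 B := by
      refine hardyNorm_mono le_rfl fun z hz => ?_
      simpa [abs_of_nonneg hr0] using hAB z hz
    rw [hardyNorm_C_mul le_rfl, Complex.norm_real, Real.norm_of_nonneg hr0] at h2
    have h3 := hN 0 (by simp)
    rw [C_0, zero_mul, add_zero] at h3
    rw [h1, mul_comm]
    exact h2.trans h3
  · have hpt : ∀ z : ℂ, ‖z‖ = 1 → ‖A.eval z‖ ^ p * hardyNorm p (X + C (r : ℂ)) ^ p ≤
        Real.circleAverage (fun ω : ℂ => ‖(B + C ω * A).eval z‖ ^ p) 0 1 := by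
      intro z hz
      have h1 : hardyNorm p (C (A.eval z) * X + C (A.eval z * r)) ≤
          hardyNorm p (C (A.eval z) * X + C (B.eval z)) := by
        refine hardyNorm_linear_mono_const hp.le _ ?_
        rw [norm_mul, Complex.norm_real, Real.norm_of_nonneg hr0, mul_comm]
        exact hAB z hz
      rw [C_mul, ← mul_add, hardyNorm_C_mul hp.le] at h1
      rw [← Real.mul_rpow (norm_nonneg _) (hardyNorm_nonneg _ _)]
      refine (Real.rpow_le_rpow (mul_nonneg (norm_nonneg _) (hardyNorm_nonneg _ _)) h1
        hp.le).trans_eq ?_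
      rw [hardyNorm_rpow hp]
      congr 1; ext ω
      simp only [eval_add, eval_mul, eval_C, eval_X]
      rw [add_comm, mul_comm]
    have hF : Continuous fun x : ℂ × ℂ => ‖(B + C x.2 * A).eval x.1‖ ^ p := by
      refine Continuous.rpow_const ?_ fun _ => Or.inr hp.le
      simp only [eval_add, eval_mul, eval_C]
      have := A.continuous
      have := B.continuous
      fun_prop
    rw [← Real.rpow_le_rpow_iff (mul_nonneg (hardyNorm_nonneg _ _) (hardyNorm_nonneg _ _)) hN0 hp,
      Real.mul_rpow (hardyNorm_nonneg _ _) (hardyNorm_nonneg _ _)]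
    calc hardyNorm p A ^ p * hardyNorm p (X + C (r : ℂ)) ^ p
        = Real.circleAverage
            (fun z => ‖A.eval z‖ ^ p * hardyNorm p (X + C (r : ℂ)) ^ p) 0 1 := by
          have h := Real.circleAverage_fun_smul (a := hardyNorm p (X + C (r : ℂ)) ^ p)
            (f := fun z : ℂ => ‖A.eval z‖ ^ p) (c := 0) (R := 1)
          simp only [smul_eq_mul] at h
          rw [hardyNorm_rpow hp A, mul_comm, ← h]
          simp only [mul_comm]
      _ ≤ Real.circleAverage (fun z => Real.circleAverage
            (fun ω : ℂ => ‖(B + C ω * A).eval z‖ ^ p) 0 1) 0 1 := by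
          refine Real.circleAverage_mono (circleIntegrable_of_continuous
            ((continuous_norm_eval_rpow A hp.le).mul continuous_const))
            (circleIntegrable_of_continuous (continuous_circleAverage_left hF)) fun z hz => ?_
          exact hpt z (by simpa using hz)
      _ = Real.circleAverage (fun ω => Real.circleAverage
            (fun z : ℂ => ‖(B + C ω * A).eval z‖ ^ p) 0 1) 0 1 :=
          circleAverage_circleAverage_swap hF
      _ ≤ N ^ p := by
          refine Real.circleAverage_mono_on_of_le_circle (circleIntegrable_of_continuous
            (continuous_circleAverage_left (hF.comp continuous_swap))) fun ω hω => ?_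
          rw [← hardyNorm_rpow hp]
          have hω : ‖ω‖ = 1 := by simpa using hω
          exact Real.rpow_le_rpow (hardyNorm_nonneg _ _) (hN ω hω.le) hp.le

/-! ### Polynomials without zeros in a disc -/

theorem one_add_X_pow_mul_eval_ne_zero {n s : ℕ} (hs0 : 0 < s) {ω z : ℂ} (hω : ‖ω‖ ≤ 1)
    (hz : ‖z‖ < 1) : ((1 + X) ^ (n - s) * (1 + C ω * X ^ s) : ℂ[X]).eval z ≠ 0 := by
  simp only [eval_mul, eval_pow, eval_add, eval_one, eval_X, eval_C]
  refine mul_ne_zero (pow_ne_zero _ fun h => ?_) fun h => ?_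
  · exact hz.ne (norm_eq_one_of_one_add_eq_zero h)
  · have h1 := norm_eq_one_of_one_add_eq_zero h
    rw [norm_mul, norm_pow] at h1
    have h2 := pow_lt_one₀ (norm_nonneg z) hz hs0.ne'
    nlinarith [norm_nonneg ω, pow_nonneg (norm_nonneg z) s]

theorem one_add_X_pow_mul_natDegree_le {n s : ℕ} (hs : s ≤ n) (ω : ℂ) :
    ((1 + X) ^ (n - s) * (1 + C ω * X ^ s) : ℂ[X]).natDegree ≤ n := by
  have h1 : ((1 + X : ℂ[X]) ^ (n - s)).natDegree ≤ n - s :=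
    natDegree_pow_le_of_le (n - s) (by compute_degree : (1 + X : ℂ[X]).natDegree ≤ 1) |>.trans
      (by omega)
  have h2 : (1 + C ω * X ^ s : ℂ[X]).natDegree ≤ s := by compute_degree
  exact (natDegree_mul_le_of_le h1 h2).trans (by omega)

theorem szego_one_add_X_pow_mul (n s : ℕ) (ω : ℂ) (P : ℂ[X]) :
    szego n ((1 + X) ^ (n - s) * (1 + C ω * X ^ s)) P =
      szego n ((1 + X) ^ (n - s)) P + C ω * szego n ((1 + X) ^ (n - s) * X ^ s) P := by
  rw [← szego_C_mul_left, ← szego_add_left]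
  congr 1
  ring

/-- Composition with `(1 + z) ^ (n - s) * z ^ s` is a normalised `s`-th derivative. -/
theorem szego_eq_hasseDeriv {n s : ℕ} (hs : s ≤ n) {P : ℂ[X]} (hP : P.natDegree ≤ n) :
    szego n ((1 + X) ^ (n - s) * X ^ s) P =
      C ((n.choose s : ℂ)⁻¹) * (X ^ s * hasseDeriv s P) := by
  ext j
  rw [szego_coeff, coeff_C_mul, coeff_mul_X_pow', coeff_X_pow_mul']
  split_ifs with h
  · rw [hasseDeriv_coeff, Nat.sub_add_cancel h, coeff_one_add_X_pow]
    rcases le_or_gt j n with hj | hj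
    · have c0 : (n.choose j : ℂ) ≠ 0 := by exact_mod_cast (Nat.choose_pos hj).ne'
      have c1 : (n.choose s : ℂ) ≠ 0 := by exact_mod_cast (Nat.choose_pos hs).ne'
      have key : (n.choose j : ℂ) * j.choose s = n.choose s * (n - s).choose (j - s) := by
        exact_mod_cast Nat.choose_mul h (n := n)
      field_simp
      linear_combination -P.coeff j * key
    · rw [coeff_eq_zero_of_natDegree_lt (by omega : P.natDegree < j)]; simp
  · simp

/-- The comparison behind the factor `‖ρ ^ s + z‖_p`. Up to the same constant, the two compositions
are `z ^ s P⁽ˢ⁾(z)` and the polynomial whose modulus on the unit circle is that of `Q⁽ˢ⁾(z)`, where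
`Q(z) = z ^ n * conj (P (1 / conj z))`. For `‖ω‖ ≤ ρ ^ s` the multiplier
`(1 + z) ^ (n - s) * (1 + ω * z ^ s)` composed with `z ↦ z / ρ` has no zero in the open unit disc,
and neither has `P (ρ z)`, so that Szegő's theorem applies to the pair. -/
theorem rho_pow_mul_norm_szego_le {n s : ℕ} (hs0 : 0 < s) (hs : s ≤ n) {P : ℂ[X]}
    (hPn : P.natDegree ≤ n) {ρ : ℝ} (hρ : 1 ≤ ρ) (hP : ∀ z : ℂ, ‖z‖ < ρ → P.eval z ≠ 0)
    {z : ℂ} (hz : ‖z‖ = 1) :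
    ρ ^ s * ‖(szego n ((1 + X) ^ (n - s) * X ^ s) P).eval z‖ ≤
      ‖(szego n ((1 + X) ^ (n - s)) P).eval z‖ := by
  have hρ0 : 0 < ρ := by linarith
  have hρc : (ρ : ℂ) ≠ 0 := by exact_mod_cast hρ0.ne'
  set A := szego n ((1 + X) ^ (n - s) * X ^ s) P with hA
  set B := szego n ((1 + X) ^ (n - s)) P with hB
  have hne : ∀ w : ℂ, ‖w‖ < 1 → ∀ ω : ℂ, ‖ω‖ ≤ ρ ^ s → B.eval w + ω * A.eval w ≠ 0 := by
    intro w hw ω hω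
    -- the dilation by `ρ` is moved from `P` to the multiplier
    have hdil : szego n ((1 + X) ^ (n - s) * (1 + C ω * X ^ s)) P =
        szego n (((1 + X) ^ (n - s) * (1 + C ω * X ^ s)).comp (C (ρ : ℂ)⁻¹ * X))
          (P.comp (C (ρ : ℂ) * X)) := by
      ext j
      have hj : ((ρ : ℂ)⁻¹) ^ j * (ρ : ℂ) ^ j = 1 := by
        rw [← mul_pow, inv_mul_cancel₀ hρc, one_pow]
      simp only [szego_coeff, comp_C_mul_X_coeff]
      linear_combination (-(((1 + X) ^ (n - s) * (1 + C ω * X ^ s)).coeff j * P.coeff j /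
        (n.choose j : ℂ))) * hj
    have hsum : B.eval w + ω * A.eval w =
        (szego n ((1 + X) ^ (n - s) * (1 + C ω * X ^ s)) P).eval w := by
      rw [szego_one_add_X_pow_mul]; simp [hA, hB]
    rw [hsum, hdil]
    refine szego_eval_ne_zero (natDegree_comp_C_mul_X_le (one_add_X_pow_mul_natDegree_le hs ω) _)
      (natDegree_comp_C_mul_X_le hPn _) (fun v hv => ?_) (fun v hv => ?_) hw
    · have h := one_add_X_pow_mul_eval_ne_zero (n := n) hs0 (ω := ω / ρ ^ s) (z := v) ?_ hv
      · simp only [eval_comp, eval_mul, eval_pow, eval_add, eval_one, eval_X, eval_C] at h ⊢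
        refine mul_ne_zero (pow_ne_zero _ fun h0 => ?_) ?_
        · have h1 := norm_eq_one_of_one_add_eq_zero h0
          rw [norm_mul, norm_inv, Complex.norm_real, Real.norm_of_nonneg hρ0.le] at h1
          have h2 := inv_le_one_of_one_le₀ hρ
          nlinarith [norm_nonneg v]
        · have := right_ne_zero_of_mul h
          rwa [mul_pow, inv_pow, ← mul_assoc, ← div_eq_mul_inv]
      · rw [norm_div, norm_pow, Complex.norm_real, Real.norm_of_nonneg hρ0.le]
        exact div_le_one_of_le₀ hω (by positivity)
    · rw [eval_comp, eval_mul, eval_C, eval_X]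
      refine hP _ ?_
      rw [norm_mul, Complex.norm_real, Real.norm_of_nonneg hρ0.le]
      nlinarith
  have hle : ∀ w : ℂ, ‖w‖ < 1 → ‖(C ((ρ : ℂ) ^ s) * A).eval w‖ ≤ ‖B.eval w‖ := by
    intro w hw
    by_contra! hlt
    rw [eval_mul, eval_C, norm_mul, norm_pow, Complex.norm_real, Real.norm_of_nonneg hρ0.le] at hlt
    have hA0 : A.eval w ≠ 0 := by
      intro h0
      rw [h0, norm_zero, mul_zero] at hlt
      exact absurd hlt (not_lt.2 (norm_nonneg _))
    refine hne w hw (-(B.eval w / A.eval w)) ?_ ?_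
    · rw [norm_neg, norm_div]
      exact (div_le_iff₀ (norm_pos_iff.2 hA0)).2 hlt.le
    · rw [neg_mul, div_mul_cancel₀ _ hA0, add_neg_cancel]
  have := norm_eval_le_of_forall_lt_one hle hz
  rwa [eval_mul, eval_C, norm_mul, norm_pow, Complex.norm_real,
    Real.norm_of_nonneg hρ0.le] at this

/-- The case `s > 0`: Visser's inequality for the `s`-th derivative, combined with the bound
`‖P⁽ˢ⁾‖_p ≤ n! / (n - s)! * ‖P‖_p / ‖ρ ^ s + z‖_p`. -/
theorem hardyNorm_visser_mul_le {n s : ℕ} (hs0 : 0 < s) (hs : s < n) {P : ℂ[X]}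
    (hPn : P.natDegree ≤ n) {ρ : ℝ} (hρ : 1 ≤ ρ) (hP : ∀ z : ℂ, ‖z‖ < ρ → P.eval z ≠ 0)
    {p : ℝ} (hp : 0 ≤ p) :
    hardyNorm p (C (P.coeff n) * X + C (P.coeff s / (n.choose s : ℂ))) *
      hardyNorm p (X + C ((ρ : ℂ) ^ s)) ≤ hardyNorm p P := by
  have c1 : (n.choose s : ℂ) ≠ 0 := by exact_mod_cast (Nat.choose_pos hs.le).ne'
  set A := szego n ((1 + X) ^ (n - s) * X ^ s) P with hA
  have h1 : hardyNorm p A * hardyNorm p (X + C ((ρ : ℂ) ^ s)) ≤ hardyNorm p P := by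
    rw [← Complex.ofReal_pow]
    refine hardyNorm_mul_hardyNorm_le (B := szego n ((1 + X) ^ (n - s)) P) hp
      (one_le_pow₀ hρ) (fun z hz => rho_pow_mul_norm_szego_le hs0 hs.le hPn hρ hP hz)
      fun ω hω => ?_
    rw [← szego_one_add_X_pow_mul]
    refine hardyNorm_szego_le (one_add_X_pow_mul_natDegree_le hs.le ω) hPn
      (fun z hz => one_add_X_pow_mul_eval_ne_zero hs0 hω hz) ?_ hp
    rw [coeff_zero_eq_eval_zero]
    simp [hs0.ne']
  have h2 : hardyNorm p (C (P.coeff n) * X + C (P.coeff s / (n.choose s : ℂ))) ≤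
      hardyNorm p A := by
    have hdeg : (hasseDeriv s P).natDegree ≤ n - s :=
      (natDegree_hasseDeriv_le P s).trans (Nat.sub_le_sub_right hPn s)
    have h3 := hardyNorm_leading_add_constant_le hp (Nat.sub_pos_of_lt hs) hdeg
    rw [hasseDeriv_coeff, hasseDeriv_coeff, Nat.sub_add_cancel hs.le, zero_add,
      Nat.choose_self, Nat.cast_one, one_mul] at h3
    have h4 : C (P.coeff n) * X + C (P.coeff s / (n.choose s : ℂ)) =
        C ((n.choose s : ℂ)⁻¹) * (C (n.choose s * P.coeff n) * X + C (P.coeff s)) := by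
      rw [mul_add, ← mul_assoc, ← C_mul, ← C_mul, inv_mul_cancel_left₀ c1, div_eq_inv_mul]
    have h5 : hardyNorm p (X ^ s * hasseDeriv s P) = hardyNorm p (hasseDeriv s P) :=
      hardyNorm_congr hp fun z hz => by simp [hz]
    rw [hA, szego_eq_hasseDeriv hs.le hPn, h4, hardyNorm_C_mul hp, hardyNorm_C_mul hp, h5]
    gcongr
  exact (mul_le_mul_of_nonneg_right h2 (hardyNorm_nonneg _ _)).trans h1

theorem hardyNorm_X_add_C_pos {p : ℝ} (hp : 0 ≤ p) {c : ℂ} (hc : c ≠ 0) :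
    0 < hardyNorm p (X + C c) := by
  have h := norm_le_hardyNorm_C_mul_X_add_C hp 1 c
  rw [C_1, one_mul] at h
  exact (norm_pos_iff.2 hc).trans_le h

theorem theorem3 (n : ℕ) (P : ℂ[X]) (hdeg : P.degree = (n : WithBot ℕ))
    (ρ : ℝ) (hρ : 1 ≤ ρ) (hP : ∀ z : ℂ, ‖z‖ < ρ → P.eval z ≠ 0)
    (p : ℝ) (hp : 0 ≤ p) (s : ℕ) (hs : s < n) :
    hardyNorm p (C (P.coeff n) * X + C (P.coeff s / (n.choose s : ℂ))) ≤
        visserConst p s * (hardyNorm p (1 + X) / hardyNorm p (C ((ρ : ℂ) ^ s) + X)) *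
          hardyNorm p P ∧
      (s = 0 → (∀ j : ℕ, 1 ≤ j → j < n → P.coeff j = 0) →
        hardyNorm p (C (P.coeff n) * X + C (P.coeff s / (n.choose s : ℂ))) =
          visserConst p s * (hardyNorm p (1 + X) / hardyNorm p (C ((ρ : ℂ) ^ s) + X)) *
            hardyNorm p P) := by
  have hPn : P.natDegree ≤ n := natDegree_le_of_degree_le hdeg.le
  have hρc : (ρ : ℂ) ≠ 0 := by
    have : ρ ≠ 0 := by linarith
    exact_mod_cast this
  have hden : 0 < hardyNorm p (C ((ρ : ℂ) ^ s) + X) := by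
    rw [add_comm]; exact hardyNorm_X_add_C_pos hp (pow_ne_zero s hρc)
  have hone : 0 < hardyNorm p (1 + X) := by
    rw [add_comm, ← C_1]; exact hardyNorm_X_add_C_pos hp one_ne_zero
  rcases Nat.eq_zero_or_pos s with rfl | hs0
  · have hconst : visserConst p 0 *
        (hardyNorm p (1 + X) / hardyNorm p (C ((ρ : ℂ) ^ 0) + X)) = 1 := by
      rw [visserConst, if_pos rfl, pow_zero, C_1, div_self hone.ne', one_mul]
    rw [hconst, one_mul, Nat.choose_zero_right, Nat.cast_one, div_one]
    refine ⟨hardyNorm_leading_add_constant_le hp hs hPn, fun _ h0 => ?_⟩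
    rw [← hardyNorm_C_mul_X_pow_add_C p hs]
    congr 1
    ext j
    simp only [coeff_add, coeff_C_mul, coeff_X_pow, coeff_C]
    rcases eq_or_ne j 0 with rfl | hj0
    · simp [hs.ne]
    · rcases lt_trichotomy j n with hj | rfl | hj
      · simp [hj0, hj.ne, h0 j (Nat.pos_of_ne_zero hj0) hj]
      · simp [hj0]
      · simp [hj0, hj.ne', coeff_eq_zero_of_natDegree_lt (hPn.trans_lt hj)]
  · refine ⟨?_, fun h => absurd h hs0.ne'⟩
    have h := hardyNorm_visser_mul_le hs0 hs hPn hρ hP hp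
    rw [visserConst, if_neg hs0.ne']
    rw [add_comm X] at h
    have hconst : 1 / hardyNorm p (1 + X) *
        (hardyNorm p (1 + X) / hardyNorm p (C ((ρ : ℂ) ^ s) + X)) * hardyNorm p P =
        hardyNorm p P / hardyNorm p (C ((ρ : ℂ) ^ s) + X) := by
      field_simp
    rw [hconst, le_div_iff₀ hden]
    exact h
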